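/- Let $q$ be a prime power with $q \equiv 1 \pmod 4$ and let $g_1 = x^2 + ax + 1 \in \mathbb{F}_q[x]$ be irreducible over $\mathbb{F}_q$. For $k \ge 1$ define recursively $g_{k+1} = g_k^R$, where $g^R$ denotes Cohen's $R$-transform $$g^R(x) = (2x)^{\deg g}\, g\!\left(\tfrac12\left(x + \tfrac1x\right)\right).$$ Then for every $k \ge 1$ the polynomial $g_k$ is irreducible over $\mathbb{F}_q$ of degree $n = 2^k$, and every root $\alpha \in \mathbb{F}_{q^n}$ of $g_k$ is completely normal in the extension $\mathbb{F}_{q^n}/\mathbb{F}_q$; that is, for every divisor $d$ of $n$, the elements $\alpha, \alpha^{Q}, \alpha^{Q^2}, \ldots, \alpha^{Q^{n/d-1}}$, where $Q = q^d$, are linearly independent over $\mathbb{F}_{q^d}$. -/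

import Mathlib

open Polynomial

/-- Cohen's `R`-transform `g ↦ (2x)^n * g((x + 1/x)/2)`, where `n = deg g`, written out as a
polynomial: `(2x)^n * ((x + 1/x)/2)^i = (2x)^(n-i) * (x^2+1)^i` for `i ≤ n`.
See `aeval_cohenRTransform` for the defining identity. -/
noncomputable def cohenRTransform {F : Type*} [Field F] (g : F[X]) : F[X] :=
  ∑ i ∈ Finset.range (g.natDegree + 1),
    C (g.coeff i) * (2 * X) ^ (g.natDegree - i) * (X ^ 2 + 1) ^ i

/-- The defining identity of the transform, at every nonzero point of every field extension
of odd characteristic (in particular at the indeterminate of the rational function field). -/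
theorem aeval_cohenRTransform {F E : Type*} [Field F] [Field E] [Algebra F E]
    (h2 : (2 : E) ≠ 0) (g : F[X]) (x : E) (hx : x ≠ 0) :
    aeval x (cohenRTransform g) = (2 * x) ^ g.natDegree * aeval ((x + 1 / x) / 2) g := by
  rw [aeval_eq_sum_range (p := g) ((x + 1 / x) / 2), Finset.mul_sum, cohenRTransform, map_sum]
  refine Finset.sum_congr rfl fun i hi => ?_
  have hi' : i ≤ g.natDegree := by
    have := Finset.mem_range.1 hi
    omega
  have h : x ^ 2 + 1 = (2 * x) * ((x + 1 / x) / 2) := by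
    field_simp
  simp only [map_mul, map_pow, map_add, map_one, map_ofNat, aeval_X, aeval_C, Algebra.smul_def]
  rw [h, mul_pow (2 * x) _ i, ← Nat.sub_add_cancel hi', pow_add, Nat.add_sub_cancel]
  ring

/-- For a finite extension `L / K` of finite fields, of degree `m`, with `|K| = Q`: the element
`α` is normal in `L / K` if `α, α^Q, …, α^(Q^(m-1))` are linearly independent over `K`. -/
def IsNormalElement (K L : Type*) [Field K] [Field L] [Algebra K L] (α : L) : Prop :=
  LinearIndependent K (fun i : Fin (Module.finrank K L) => α ^ (Nat.card K ^ (i : ℕ)))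

/-- `α` is completely normal in `L / K` if it is normal in `L / M` for every intermediate
field `M` (for `K = 𝔽_q`, `L = 𝔽_{q^n}` these are the fields `𝔽_{q^d}` with `d ∣ n`). -/
def IsCompletelyNormalElement (K L : Type*) [Field K] [Field L] [Algebra K L] (α : L) : Prop :=
  ∀ M : IntermediateField K L, IsNormalElement M L α

/-! The Cayley transform β = (α - 1)/(α + 1) turns the substitution x ↦ (x + 1/x)/2 into squaring,
so a root α of g_k gives β^(2^k) = b with b = (a + 2)/(a - 2), a nonsquare because a² - 4 is one. As
q ≡ 1 mod 4, X^(2^k) - b is irreducible (`minpoly_eq_X_pow_two_pow_sub_C`), hence α has degree 2^k.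

Over an intermediate field M with [L : M] = 2^s, c = β^(2^s) is a nonsquare of M, and α = (1 + β)/(1
- β) is a combination of 1, β, …, β^(2^s - 1) with no zero coefficient. Normality means that no
nonzero polynomial of degree < 2^s in the Frobenius of M kills α.
`X_pow_sub_C_dvd_of_aeval_frobenius_eq_zero` gives this: splitting the sum by parity of the exponent
mirrors X^(2m) - θ² = (X^m - θ)(X^m + θ), and the recursion stops at irreducible factors. -/

theorem ne_zero_of_pow_eq_nonsquare {K L : Type*} [Field K] [Field L] [Algebra K L]
    {c : K} (hc : ¬IsSquare c) {n : ℕ} (hn : n ≠ 0)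
    {γ : L} (hγ : γ ^ n = algebraMap K L c) : γ ≠ 0 := by
  rintro rfl
  rw [zero_pow hn, eq_comm, map_eq_zero] at hγ
  simp [hγ] at hc

/-! ### Frobenius action on 2-power roots of a nonsquare -/

section FrobeniusPowers

variable {K L : Type*} [Field K] [Finite K] [Field L] [Algebra K L]

theorem two_ne_zero_of_card_modEq (hK : Nat.card K ≡ 1 [MOD 4]) : (2 : K) ≠ 0 := by
  have := Fintype.ofFinite K
  rw [Nat.card_eq_fintype_card] at hK
  refine Ring.two_ne_zero fun h => ?_
  have := FiniteField.even_card_of_char_two h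
  unfold Nat.ModEq at hK
  omega

theorem isSquare_neg_one_of_card_modEq (hK : Nat.card K ≡ 1 [MOD 4]) : IsSquare (-1 : K) := by
  have := Fintype.ofFinite K
  rw [Nat.card_eq_fintype_card] at hK
  rw [FiniteField.isSquare_neg_one_iff]
  unfold Nat.ModEq at hK
  omega

theorem algebraMap_pow_natCard_pow (c : K) (n : ℕ) :
    algebraMap K L c ^ Nat.card K ^ n = algebraMap K L c := by
  have := Fintype.ofFinite K
  rw [← map_pow, Nat.card_eq_fintype_card, FiniteField.pow_card_pow]

/-- A root of `X ^ (2 * 2 ^ d) - c`, with `c` a nonsquare, is negated by the `2 ^ d`-th power of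
the Frobenius. -/
theorem pow_natCard_pow_eq_neg (hK : Nat.card K ≡ 1 [MOD 4]) {c : K} (hc : ¬IsSquare c) (d : ℕ)
    (γ : L) (hγ : γ ^ 2 ^ (d + 1) = algebraMap K L c) :
    γ ^ Nat.card K ^ 2 ^ d = -γ := by
  induction d generalizing γ with
  | zero =>
    have hc0 : c ≠ 0 := by rintro rfl; simp at hc
    have := Fintype.ofFinite K
    have hchar : ringChar K ≠ 2 := fun h => two_ne_zero_of_card_modEq hK (by
      have := ringChar.spec K 2
      simpa [h] using this)
    have h1 : c ^ (Fintype.card K / 2) = -1 :=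
      (FiniteField.pow_dichotomy hchar hc0).resolve_left
        fun h => hc ((FiniteField.isSquare_iff hchar hc0).2 h)
    have hQ : Nat.card K = 2 * (Fintype.card K / 2) + 1 := by
      rw [Nat.card_eq_fintype_card] at hK ⊢
      unfold Nat.ModEq at hK
      omega
    rw [pow_zero, pow_one, hQ, pow_succ, pow_mul]
    simp only [zero_add, pow_one] at hγ
    rw [hγ, ← map_pow, h1]
    simp
  | succ d ih =>
    -- γ² is negated by the 2^d-th Frobenius power, so γ is multiplied by a square root of -1. That
    -- root lies in K, so applying the power again negates γ.
    have h := ih (γ ^ 2) (by rw [← pow_mul, ← pow_succ', hγ])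
    obtain ⟨i, hi⟩ := isSquare_neg_one_of_card_modEq hK
    have hi' : algebraMap K L i * algebraMap K L i = -1 := by rw [← map_mul, ← hi]; simp
    have key : ∀ j : K, j * j = -1 → γ ^ Nat.card K ^ 2 ^ d = algebraMap K L j * γ →
        γ ^ Nat.card K ^ 2 ^ (d + 1) = -γ := by
      intro j hj hγj
      have hj' : algebraMap K L j * algebraMap K L j = -1 := by rw [← map_mul, hj]; simp
      rw [pow_succ 2 d, mul_two, pow_add (Nat.card K), pow_mul, hγj, mul_pow, hγj,
        algebraMap_pow_natCard_pow, ← mul_assoc, hj', neg_one_mul]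
    have h2 : (γ ^ Nat.card K ^ 2 ^ d - algebraMap K L i * γ) *
        (γ ^ Nat.card K ^ 2 ^ d + algebraMap K L i * γ) = 0 := by
      rw [← pow_mul, mul_comm 2, pow_mul] at h
      linear_combination h - γ ^ 2 * hi'
    rcases mul_eq_zero.1 h2 with h3 | h3
    · exact key i hi.symm (sub_eq_zero.1 h3)
    · exact key (-i) (by rw [neg_mul_neg, hi]) (by rw [map_neg]; linear_combination h3)

theorem pow_natCard_pow_eq_self (hK : Nat.card K ≡ 1 [MOD 4]) {c : K} (hc : ¬IsSquare c) (d : ℕ)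
    (γ : L) (hγ : γ ^ 2 ^ d = algebraMap K L c) :
    γ ^ Nat.card K ^ 2 ^ d = γ := by
  cases d with
  | zero =>
    simp only [pow_zero, pow_one] at hγ ⊢
    simpa [hγ] using algebraMap_pow_natCard_pow (L := L) c 1
  | succ d =>
    have h := pow_natCard_pow_eq_neg hK hc d γ hγ
    have hodd : Odd (Nat.card K) := by
      rw [Nat.odd_iff]; unfold Nat.ModEq at hK; omega
    rw [pow_succ 2 d, mul_two, pow_add (Nat.card K), pow_mul, h, (hodd.pow).neg_pow, h, neg_neg]

/-- The degree of γ divides n exactly when the n-th Frobenius power fixes γ. This happens for n =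
2^d but not for n = 2^(d-1), where γ is negated. -/
theorem minpoly_eq_X_pow_two_pow_sub_C (hK : Nat.card K ≡ 1 [MOD 4]) {c : K} (hc : ¬IsSquare c)
    (d : ℕ) {γ : L} (hγ : γ ^ 2 ^ d = algebraMap K L c) :
    minpoly K γ = X ^ 2 ^ d - C c := by
  have hpos : (2 ^ d : ℕ) ≠ 0 := by positivity
  have hroot : aeval γ (X ^ 2 ^ d - C c) = 0 := by simp [hγ]
  have hmonic : (X ^ 2 ^ d - C c).Monic := monic_X_pow_sub_C c hpos
  have hint : IsIntegral K γ := ⟨_, hmonic, hroot⟩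
  have hirr := minpoly.irreducible hint
  have hdeg : (X ^ 2 ^ d - C c).natDegree = 2 ^ d := natDegree_X_pow_sub_C
  have hiff : ∀ n : ℕ, γ ^ Nat.card K ^ n = γ ↔ (minpoly K γ).natDegree ∣ n := by
    intro n
    rw [hirr.natDegree_dvd_iff_dvd_X_pow_card_pow_sub_X, minpoly.dvd_iff]
    simp [sub_eq_zero]
  have hle : 2 ^ d ≤ (minpoly K γ).natDegree := by
    obtain ⟨e, he, hde⟩ :=
      (Nat.dvd_prime_pow Nat.prime_two).1 ((hiff _).1 (pow_natCard_pow_eq_self hK hc d γ hγ))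
    rcases he.eq_or_lt with rfl | hlt
    · exact hde.ge
    · exfalso
      obtain ⟨d', rfl⟩ : ∃ d', d = d' + 1 := ⟨d - 1, by omega⟩
      have h1 := (hiff (2 ^ d')).2 (hde ▸ pow_dvd_pow 2 (by omega))
      rw [pow_natCard_pow_eq_neg hK hc d' γ hγ, neg_eq_iff_add_eq_zero, ← two_mul] at h1
      have h2 : (2 : L) ≠ 0 := by
        rw [← map_ofNat (algebraMap K L) 2]
        exact (_root_.map_ne_zero _).2 (two_ne_zero_of_card_modEq hK)
      exact ne_zero_of_pow_eq_nonsquare hc hpos hγ ((mul_eq_zero.1 h1).resolve_left h2)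
  exact (eq_of_monic_of_dvd_of_natDegree_le (minpoly.monic hint) hmonic
    (minpoly.dvd _ _ hroot) (by rw [hdeg]; exact hle)).symm

theorem irreducible_X_pow_two_pow_sub_C (hK : Nat.card K ≡ 1 [MOD 4]) {c : K} (hc : ¬IsSquare c)
    (d : ℕ) : Irreducible (X ^ 2 ^ d - C c) := by
  obtain ⟨γ, hγ⟩ := IsAlgClosed.exists_pow_nat_eq (algebraMap K (AlgebraicClosure K) c)
    (n := 2 ^ d) (by positivity)
  rw [← minpoly_eq_X_pow_two_pow_sub_C hK hc d hγ]
  exact minpoly.irreducible (Algebra.IsIntegral.isIntegral γ)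

theorem mem_range_algebraMap_of_pow_natCard [FiniteDimensional K L] (x : L)
    (hx : x ^ Nat.card K = x) : x ∈ Set.range (algebraMap K L) := by
  have := Fintype.ofFinite K
  have : Finite L := Module.finite_of_finite K
  rw [Nat.card_eq_fintype_card] at hx
  refine (IsGalois.mem_range_algebraMap_iff_fixed x).2 fun f => ?_
  obtain ⟨n, rfl⟩ := (FiniteField.bijective_frobeniusAlgEquivOfAlgebraic_pow K L).2 f
  change (FiniteField.frobeniusAlgEquivOfAlgebraic K L ^ n.1) x = x
  induction n.1 with
  | zero => rfl
  | succ m ih =>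
    rw [pow_succ, AlgEquiv.mul_apply]
    simpa [hx] using ih

end FrobeniusPowers

/-! ### Eigenvectors of Frobenius powers -/

/-- The ratio w = δ^(q-1) is a root of unity of 2-power order and w^(q+1) = η². Since (q + 1)/2 is
odd, w^((q+1)/2) = ±η, and an odd power of w generates the same group as w. Thus w is a power of ±η.
-/
theorem exists_pow_eq_algebraMap_mul {K L : Type*} [Field K] [Field L] [Algebra K L] {q : ℕ}
    (hq : q ≡ 1 [MOD 4]) {δ : L} (hδ : δ ≠ 0) {s : ℕ} {e : K} (he : δ ^ 2 ^ s = algebraMap K L e)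
    (heq : algebraMap K L e ^ q = algebraMap K L e) {η : K}
    (hη : δ ^ (q * q) = algebraMap K L (η * η) * δ) :
    ∃ θ : K, δ ^ q = algebraMap K L θ * δ := by
  obtain ⟨w, hw⟩ : ∃ w, δ ^ q = w * δ := ⟨δ ^ q / δ, by field_simp⟩
  have hw1 : w ^ 2 ^ s = 1 := by
    have h := congrArg (· ^ 2 ^ s) hw
    simp only [mul_pow, ← pow_mul] at h
    rw [mul_comm q, pow_mul, he, heq] at h
    have he0 : algebraMap K L e ≠ 0 := he ▸ pow_ne_zero _ hδ
    exact mul_right_cancel₀ he0 (by rw [← h, one_mul])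
  obtain ⟨o, ho⟩ : ∃ o, q = 4 * o + 1 := ⟨q / 4, by unfold Nat.ModEq at hq; omega⟩
  have hw2 : w ^ (q + 1) = algebraMap K L (η * η) := by
    rw [pow_mul, hw, mul_pow, hw, ← mul_assoc, ← pow_succ] at hη
    exact mul_right_cancel₀ hδ hη
  have hw3 : w ^ (2 * o + 1) = algebraMap K L η ∨ w ^ (2 * o + 1) = -algebraMap K L η := by
    rw [← sq_eq_sq_iff_eq_or_eq_neg, ← pow_mul, sq, ← map_mul, ← hw2, ho]
    congr 1
    ring
  have hcop : (2 * o + 1).Coprime (orderOf w) := by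
    refine Nat.Coprime.coprime_dvd_right (orderOf_dvd_of_pow_eq_one hw1) (Nat.Coprime.pow_right _ ?_)
    simp
  obtain ⟨m, hm⟩ := exists_pow_eq_self_of_coprime hcop
  rcases hw3 with h | h
  · exact ⟨η ^ m, by rw [hw, ← hm, h, map_pow]⟩
  · exact ⟨(-η) ^ m, by rw [hw, ← hm, h, map_pow, map_neg]⟩

theorem pow_apply_of_frobenius {K L : Type*} [Field K] [Field L] [Algebra K L]
    {σ : Module.End K L} (hσ : ∀ x, σ x = x ^ Nat.card K) (n : ℕ)
    (x : L) : (σ ^ n) x = x ^ Nat.card K ^ n := by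
  induction n with
  | zero => simp
  | succ n ih => rw [pow_succ', Module.End.mul_apply, ih, hσ, ← pow_mul, pow_succ]

theorem pow_apply_mul_sum {K L : Type*} [Field K] [Field L] [Algebra K L]
    {σ : Module.End K L} (hσ : ∀ x, σ x = x ^ Nat.card K) {n : ℕ}
    {γ δ : L} {ξ : K} (hγ : γ ^ Nat.card K ^ n = γ)
    (hδ : δ ^ Nat.card K ^ n = algebraMap K L ξ * δ) (s : Finset ℕ) (a : ℕ → K) :
    (σ ^ n) (δ * ∑ k ∈ s, a k • γ ^ k) = ξ • (δ * ∑ k ∈ s, a k • γ ^ k) := by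
  have h : (∑ k ∈ s, a k • γ ^ k) ^ Nat.card K ^ n = ∑ k ∈ s, a k • γ ^ k := by
    rw [← pow_apply_of_frobenius hσ, map_sum]
    refine Finset.sum_congr rfl fun k _ => ?_
    rw [map_smul, pow_apply_of_frobenius hσ, ← pow_mul, mul_comm k, pow_mul, hγ]
  rw [pow_apply_of_frobenius hσ, mul_pow, h, hδ, Algebra.smul_def, mul_assoc]

/-! ### Annihilators under Frobenius -/

section FrobeniusAnnihilator

variable {K L : Type*} [Field K] [Finite K] [Field L] [Algebra K L]

theorem sum_smul_pow_ne_zero (hK : Nat.card K ≡ 1 [MOD 4]) {c : K} (hc : ¬IsSquare c)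
    {d : ℕ} {γ : L} (hγ : γ ^ 2 ^ d = algebraMap K L c) {a : ℕ → K} (ha : a 0 ≠ 0) :
    ∑ k ∈ Finset.range (2 ^ d), a k • γ ^ k ≠ 0 := by
  intro h
  set p : K[X] := ∑ k ∈ Finset.range (2 ^ d), C (a k) * X ^ k with hp
  have hroot : aeval γ p = 0 := by simpa [hp, Algebra.smul_def] using h
  have hdeg : p.degree < (2 ^ d : ℕ) := by
    refine (degree_lt_iff_coeff_zero _ _).2 fun m hm => ?_
    simp only [hp, finsetSum_coeff, coeff_C_mul, coeff_X_pow]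
    refine Finset.sum_eq_zero fun k hk => ?_
    rw [if_neg (by have := Finset.mem_range.1 hk; omega), mul_zero]
  have hp0 : p ≠ 0 := by
    intro h0
    have := congrArg (coeff · 0) h0
    simp [hp, coeff_X_pow] at this
    exact ha this
  refine (minpoly.degree_le_of_ne_zero K γ hp0 hroot).not_gt ?_
  rwa [minpoly_eq_X_pow_two_pow_sub_C hK hc d hγ, degree_X_pow_sub_C (by positivity)]

/-- If `γ` is a `2 ^ d`-th root of a nonsquare, `δ` is an eigenvector of the `2 ^ d`-th power of
the Frobenius with eigenvalue `ξ`, and no coefficient `a k` vanishes, then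
`X ^ 2 ^ d - ξ` divides every polynomial in the Frobenius that kills `δ * ∑ k, a k • γ ^ k`. -/
theorem X_pow_sub_C_dvd_of_aeval_frobenius_eq_zero (hK : Nat.card K ≡ 1 [MOD 4]) {c : K}
    (hc : ¬IsSquare c) {σ : Module.End K L} (hσ : ∀ x, σ x = x ^ Nat.card K) (d : ℕ)
    {γ δ : L} {ξ : K} {a : ℕ → K} (ha : ∀ k, a k ≠ 0) (hγ : γ ^ 2 ^ d = algebraMap K L c)
    (hδ0 : δ ≠ 0) (hδ : δ ^ Nat.card K ^ 2 ^ d = algebraMap K L ξ * δ)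
    (hδs : ∃ (s : ℕ) (e : K), δ ^ 2 ^ s = algebraMap K L e) {f : K[X]}
    (hf : aeval σ f (δ * ∑ k ∈ Finset.range (2 ^ d), a k • γ ^ k) = 0) :
    X ^ 2 ^ d - C ξ ∣ f := by
  induction d generalizing γ δ ξ a with
  | zero =>
    have hu : δ * ∑ k ∈ Finset.range (2 ^ 0), a k • γ ^ k ≠ 0 :=
      mul_ne_zero hδ0 (sum_smul_pow_ne_zero hK hc hγ (ha 0))
    have heig := pow_apply_mul_sum hσ (pow_natCard_pow_eq_self hK hc 0 γ hγ) hδ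
      (Finset.range (2 ^ 0)) a
    simp only [pow_zero, pow_one] at heig hf hu
    rw [Module.End.aeval_apply_of_hasEigenvector
      ⟨Module.End.mem_eigenspace_iff.2 heig, hu⟩] at hf
    rw [pow_zero, pow_one, dvd_iff_isRoot]
    exact (smul_eq_zero.1 hf).resolve_right hu
  | succ d ih =>
    by_cases hξ : IsSquare ξ
    · obtain ⟨η, rfl⟩ := hξ
      have hmod : Nat.card K ^ 2 ^ d ≡ 1 [MOD 4] := by simpa using hK.pow (2 ^ d)
      have hsq : Nat.card K ^ 2 ^ (d + 1) = Nat.card K ^ 2 ^ d * Nat.card K ^ 2 ^ d := by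
        rw [← pow_add, ← two_mul, pow_succ']
      obtain ⟨s, e, he⟩ := hδs
      rw [hsq] at hδ
      obtain ⟨θ, hθ⟩ := exists_pow_eq_algebraMap_mul hmod hδ0 he
        (algebraMap_pow_natCard_pow e _) hδ
      have hθη : η * η = θ * θ := by
        rw [pow_mul, hθ, mul_pow, algebraMap_pow_natCard_pow, hθ, ← mul_assoc, ← map_mul] at hδ
        exact ((algebraMap K L).injective (mul_right_cancel₀ hδ0 hδ)).symm
      rw [hθη]
      have hθ0 : θ ≠ 0 := by
        rintro rfl
        rw [map_zero, zero_mul] at hθ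
        exact pow_ne_zero _ hδ0 hθ
      have hγ0 : γ ≠ 0 := ne_zero_of_pow_eq_nonsquare hc (by positivity) hγ
      have hγ2 : (γ ^ 2) ^ 2 ^ d = algebraMap K L c := by rw [← pow_mul, ← pow_succ', hγ]
      have hγneg := pow_natCard_pow_eq_neg hK hc d γ hγ
      have hδγ : (δ * γ) ^ Nat.card K ^ 2 ^ d = algebraMap K L (-θ) * (δ * γ) := by
        rw [mul_pow, hθ, hγneg, map_neg]; ring
      have hγ2' := pow_natCard_pow_eq_self hK hc d _ hγ2
      -- The even and odd parts are eigenvectors of σ^(2^d) with eigenvalues θ and -θ, and both have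
      -- the shape required by the induction, with γ² for γ.
      set u := δ * ∑ k ∈ Finset.range (2 ^ d), a (2 * k) • (γ ^ 2) ^ k with hu
      set v := δ * γ * ∑ k ∈ Finset.range (2 ^ d), a (2 * k + 1) • (γ ^ 2) ^ k with hv
      have hsplit : δ * ∑ k ∈ Finset.range (2 ^ (d + 1)), a k • γ ^ k = u + v := by
        have : ∀ n, ∑ k ∈ Finset.range (2 * n), a k • γ ^ k =
            ∑ k ∈ Finset.range n, a (2 * k) • (γ ^ 2) ^ k +
              γ * ∑ k ∈ Finset.range n, a (2 * k + 1) • (γ ^ 2) ^ k := by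
          intro n
          induction n with
          | zero => simp
          | succ n ihn =>
            rw [mul_add, mul_one, Finset.sum_range_succ, Finset.sum_range_succ, ihn,
              Finset.sum_range_succ, Finset.sum_range_succ]
            simp only [Algebra.smul_def]
            ring
        rw [pow_succ', this, hu, hv]
        ring
      have hu1 : (σ ^ 2 ^ d) u = θ • u := pow_apply_mul_sum hσ hγ2' hθ _ _
      have hv1 : (σ ^ 2 ^ d) v = (-θ) • v := pow_apply_mul_sum hσ hγ2' hδγ _ _
      have hcomm : ∀ x, (σ ^ 2 ^ d) (aeval σ f x) = aeval σ f ((σ ^ 2 ^ d) x) := by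
        intro x
        have h : Commute (σ ^ 2 ^ d) (aeval σ f) := by
          rw [← aeval_X_pow (R := K) σ]
          exact (Commute.all _ _).map (aeval σ)
        exact LinearMap.congr_fun h.eq x
      rw [hsplit, map_add] at hf
      -- Applying σ^(2^d) to f(σ)(u + v) = 0 changes the relative sign, so f(σ) kills u and v
      -- separately.
      have hf2 : θ • (aeval σ f u - aeval σ f v) = 0 := by
        have h := congrArg (fun x => (σ ^ 2 ^ d) x) hf
        simp only [map_add, map_zero] at h
        rw [hcomm, hcomm, hu1, hv1, map_smul, map_smul] at h
        rw [← h, neg_smul, smul_sub, sub_eq_add_neg]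
      have hf3 := sub_eq_zero.1 ((smul_eq_zero.1 hf2).resolve_left hθ0)
      have h2 : (2 : L) ≠ 0 := by
        rw [← map_ofNat (algebraMap K L) 2]
        exact (_root_.map_ne_zero _).2 (two_ne_zero_of_card_modEq hK)
      have hfu : aeval σ f u = 0 := by
        rw [← hf3, ← two_mul] at hf
        exact (mul_eq_zero.1 hf).resolve_left h2
      have hfv : aeval σ f v = 0 := hf3 ▸ hfu
      have d1 := ih (fun k => ha (2 * k)) hγ2 hδ0 hθ ⟨s, e, he⟩ hfu
      have d2 := ih (fun k => ha (2 * k + 1)) hγ2 (mul_ne_zero hδ0 hγ0) hδγ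
        ⟨s + (d + 1), e ^ 2 ^ (d + 1) * c ^ 2 ^ s, by
          rw [mul_pow, pow_add 2 s, pow_mul, he, mul_comm (2 ^ s), pow_mul, hγ]
          simp⟩ hfv
      have hcop : IsCoprime (X ^ 2 ^ d - C θ) (X ^ 2 ^ d - C (-θ)) := by
        have h2K := two_ne_zero_of_card_modEq hK
        refine ⟨-C (2 * θ)⁻¹, C (2 * θ)⁻¹, ?_⟩
        have : C (2 * θ)⁻¹ * C (2 * θ) = (1 : K[X]) := by
          rw [← C_mul, inv_mul_cancel₀ (mul_ne_zero h2K hθ0), C_1]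
        rw [← this, C_mul (a := 2), C_neg, show (C 2 : K[X]) = 2 from rfl]
        ring
      have hprod : (X ^ 2 ^ (d + 1) - C (θ * θ) : K[X]) =
          (X ^ 2 ^ d - C θ) * (X ^ 2 ^ d - C (-θ)) := by
        rw [pow_succ 2 d, pow_mul, C_mul, C_neg]
        ring
      rw [hprod]
      exact hcop.mul_dvd d1 d2
    -- Here X^(2^(d+1)) - ξ is irreducible and kills the nonzero vector, so f cannot be coprime to
    -- it.
    · by_contra hdvd
      obtain ⟨p, r, hpr⟩ :=
        ((irreducible_X_pow_two_pow_sub_C hK hξ (d + 1)).coprime_iff_not_dvd).2 hdvd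
      set u := δ * ∑ k ∈ Finset.range (2 ^ (d + 1)), a k • γ ^ k with hu
      have hu0 : u ≠ 0 := mul_ne_zero hδ0 (sum_smul_pow_ne_zero hK hc hγ (ha 0))
      have h1 : aeval σ (X ^ 2 ^ (d + 1) - C ξ) u = 0 := by
        rw [map_sub, aeval_X_pow, aeval_C, LinearMap.sub_apply, Module.algebraMap_end_apply,
          pow_apply_mul_sum hσ (pow_natCard_pow_eq_self hK hc _ γ hγ) hδ, sub_self]
      have h := congrArg (fun g => aeval σ g u) hpr
      simp only [map_add, map_mul, LinearMap.add_apply, Module.End.mul_apply, h1, hf, map_zero,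
        add_zero, map_one, Module.End.one_apply] at h
      exact hu0 h.symm

end FrobeniusAnnihilator

/-! ### Normality and complete normality -/

/-- The image under the inverse Cayley transform of a `2 ^ s`-th root of a nonsquare is a normal
element. -/
theorem isNormalElement_cayley {K L : Type*} [Field K] [Finite K] [Field L] [Algebra K L]
    (hK : Nat.card K ≡ 1 [MOD 4]) {c : K} (hc : ¬IsSquare c) {s : ℕ}
    (hs : Module.finrank K L = 2 ^ s) {α β : L} (hβ : β ^ 2 ^ s = algebraMap K L c)
    (hα : α * (1 - β) = 1 + β) : IsNormalElement K L α := by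
  have h2K := two_ne_zero_of_card_modEq hK
  have hc1 : 1 - c ≠ 0 := by
    intro h
    exact hc ⟨1, by linear_combination -h⟩
  have hc2 : 1 + c ≠ 0 := by
    intro h
    obtain ⟨i, hi⟩ := isSquare_neg_one_of_card_modEq hK
    exact hc ⟨i, by linear_combination h + hi⟩
  have hβ1 : 1 - β ≠ 0 := by
    intro h
    rw [← sub_eq_zero.1 h, one_pow, ← map_one (algebraMap K L)] at hβ
    exact hc1 (sub_eq_zero.2 ((algebraMap K L).injective hβ))
  have := Fintype.ofFinite K
  have hq : Nat.card K = Fintype.card K := Nat.card_eq_fintype_card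
  let σ : Module.End K L := (FiniteField.frobeniusAlgHom K L).toLinearMap
  have hσ : ∀ x, σ x = x ^ Nat.card K := fun x => by rw [hq]; rfl
  -- Obtained from (1 + β)/(1 - β) = -1 + 2/(1 - β) and (1 - β) ∑ β^k = 1 - c, summed over k < 2^s.
  -- None vanishes, as 1 and -1 are squares and c is not.
  let a : ℕ → K := fun k => if k = 0 then (1 + c) / (1 - c) else 2 / (1 - c)
  have ha : ∀ k, a k ≠ 0 := by
    intro k
    by_cases hk : k = 0 <;> simp [a, hk, hc1, hc2, h2K]
  have hsum : α = 1 * ∑ k ∈ Finset.range (2 ^ s), a k • β ^ k := by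
    have hc1' : algebraMap K L (1 - c) ≠ 0 := (_root_.map_ne_zero _).2 hc1
    have hpart : ∀ n : ℕ, algebraMap K L (1 - c) *
        (∑ k ∈ Finset.range (n + 1), a k • β ^ k) * (1 - β) =
          (1 + algebraMap K L c) * (1 - β) + 2 * (β - β ^ (n + 1)) := by
      intro n
      induction n with
      | zero =>
        have h : algebraMap K L (1 - c) * algebraMap K L (a 0) = 1 + algebraMap K L c := by
          rw [← map_mul, show (1 - c) * a 0 = 1 + c by simp [a]; field_simp, map_add, map_one]
        simp only [zero_add, Finset.sum_range_one, pow_zero, Algebra.smul_def, mul_one, h, pow_one]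
        ring
      | succ n ih =>
        have h : algebraMap K L (1 - c) * algebraMap K L (a (n + 1)) = 2 := by
          rw [← map_mul, show (1 - c) * a (n + 1) = 2 by simp [a]; field_simp, map_ofNat]
        rw [Finset.sum_range_succ, Algebra.smul_def]
        linear_combination ih + β ^ (n + 1) * (1 - β) * h
    obtain ⟨n, hn⟩ : ∃ n, 2 ^ s = n + 1 := ⟨2 ^ s - 1, by have := Nat.two_pow_pos s; omega⟩
    have h := hpart n
    rw [← hn, hβ] at h
    refine mul_left_cancel₀ hc1' (mul_right_cancel₀ hβ1 ?_)
    rw [one_mul, h, mul_assoc, hα, map_sub, map_one]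
    ring
  rw [IsNormalElement, Fintype.linearIndependent_iff]
  intro g hg
  set f : K[X] := ∑ i, C (g i) * X ^ (i : ℕ) with hf
  have hfα : aeval σ f α = 0 := by
    rw [← hg, hf, map_sum, LinearMap.sum_apply]
    refine Finset.sum_congr rfl fun i _ => ?_
    rw [map_mul, aeval_C, aeval_X_pow, Module.End.mul_apply, Module.algebraMap_end_apply,
      pow_apply_of_frobenius hσ]
  rw [hsum] at hfα
  have hdvd := X_pow_sub_C_dvd_of_aeval_frobenius_eq_zero hK hc hσ s ha hβ one_ne_zero (ξ := 1)
    (by simp) ⟨0, 1, by simp⟩ hfα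
  have hdeg : f.degree < (2 ^ s : ℕ) := by
    refine (degree_lt_iff_coeff_zero _ _).2 fun m hm => ?_
    simp only [hf, finsetSum_coeff, coeff_C_mul, coeff_X_pow]
    refine Finset.sum_eq_zero fun i _ => ?_
    rw [if_neg (by have := i.2; omega), mul_zero]
  have hf0 : f = 0 := by
    refine eq_zero_of_dvd_of_degree_lt hdvd ?_
    rwa [degree_X_pow_sub_C (by positivity)]
  intro i
  have h := congrArg (coeff · (i : ℕ)) hf0
  simpa [hf, coeff_X_pow, Fin.val_inj] using h

theorem isCompletelyNormalElement_cayley {F L : Type*} [Field F] [Finite F] [Field L]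
    [Algebra F L] (hF : Nat.card F ≡ 1 [MOD 4]) {b : F} (hb : ¬IsSquare b) {k : ℕ}
    (hk : Module.finrank F L = 2 ^ k) {α β : L} (hβ : β ^ 2 ^ k = algebraMap F L b)
    (hα : α * (1 - β) = 1 + β) : IsCompletelyNormalElement F L α := by
  intro M
  have : FiniteDimensional F L := Module.finite_of_finrank_pos (by rw [hk]; positivity)
  have hmul := Module.finrank_mul_finrank F M L
  rw [hk] at hmul
  obtain ⟨j, -, hj⟩ := (Nat.dvd_prime_pow Nat.prime_two).1 (Dvd.intro _ hmul)
  obtain ⟨s, -, hs⟩ := (Nat.dvd_prime_pow Nat.prime_two).1 (Dvd.intro_left _ hmul)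
  rw [hj, hs] at hmul
  have : Finite M := Module.finite_of_finite F
  have hM : Nat.card M = Nat.card F ^ 2 ^ j := by
    rw [← hj]; exact Module.natCard_eq_pow_finrank
  have hMmod : Nat.card M ≡ 1 [MOD 4] := by
    rw [hM]; simpa using hF.pow (2 ^ j)
  have hc : (β ^ 2 ^ s) ^ 2 ^ j = algebraMap F L b := by rw [← pow_mul, mul_comm, hmul, hβ]
  obtain ⟨c, hcβ⟩ := mem_range_algebraMap_of_pow_natCard (K := M) (β ^ 2 ^ s) (by
    rw [hM]; exact pow_natCard_pow_eq_self hF hb j _ hc)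
  refine isNormalElement_cayley hMmod (c := c) ?_ hs hcβ.symm hα
  -- A square root e of c in M would be negated by the Frobenius of M, which fixes M.
  rintro ⟨e, rfl⟩
  rw [← hcβ, map_mul, ← sq, ← pow_mul, ← pow_succ'] at hc
  have h1 := pow_natCard_pow_eq_neg hF hb j _ hc
  rw [← hM, ← pow_one (Nat.card M), algebraMap_pow_natCard_pow, ← sub_eq_zero, sub_neg_eq_add,
    ← two_mul, ← map_ofNat (algebraMap F L) 2] at h1
  exact (mul_ne_zero ((_root_.map_ne_zero _).2 (two_ne_zero_of_card_modEq hF))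
    (ne_zero_of_pow_eq_nonsquare hb (by positivity) hc)) h1

/-! ### The R-transform and its roots -/

/-- The i-th summand has degree at most n + i, so only i = n reaches 2n. -/
theorem cohenRTransform_coeff_two_mul {F : Type*} [Field F] (g : F[X]) :
    (cohenRTransform g).natDegree ≤ 2 * g.natDegree ∧
      (cohenRTransform g).coeff (2 * g.natDegree) = g.leadingCoeff := by
  set n := g.natDegree with hn
  have hlow : (∑ i ∈ Finset.range n,
      C (g.coeff i) * (2 * X) ^ (n - i) * (X ^ 2 + 1) ^ i).degree <
        ((2 * n : ℕ) : WithBot ℕ) := by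
    refine (degree_sum_le _ _).trans_lt ?_
    refine (Finset.sup_lt_iff (WithBot.bot_lt_coe _)).2 fun i hi => ?_
    have hi' := Finset.mem_range.1 hi
    have : (C (g.coeff i) * (2 * X) ^ (n - i) * (X ^ 2 + 1) ^ i : F[X]).natDegree ≤
        0 + (n - i) * 1 + i * 2 := by
      refine natDegree_mul_le_of_le (natDegree_mul_le_of_le (natDegree_C _).le ?_) ?_
      · refine natDegree_pow_le_of_le _ ?_
        rw [show (2 : F[X]) = C 2 from rfl]
        exact (natDegree_C_mul_le _ _).trans natDegree_X_le
      · refine natDegree_pow_le_of_le _ ?_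
        compute_degree
    refine degree_le_natDegree.trans_lt ?_
    exact_mod_cast (by omega)
  have hm : ((X ^ 2 + 1 : F[X]) ^ n).Monic := Monic.pow (by monicity!) n
  have hmd : ((X ^ 2 + 1 : F[X]) ^ n).natDegree = 2 * n := by
    rw [natDegree_pow, show (X ^ 2 + 1 : F[X]).natDegree = 2 by compute_degree!, mul_comm]
  have htop : cohenRTransform g = ∑ i ∈ Finset.range n,
      C (g.coeff i) * (2 * X) ^ (n - i) * (X ^ 2 + 1) ^ i + C g.leadingCoeff * (X ^ 2 + 1) ^ n := by
    rw [cohenRTransform, Finset.sum_range_succ, ← hn, Nat.sub_self, pow_zero, mul_one]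
    rfl
  rw [htop]
  constructor
  · refine (natDegree_add_le_of_degree_le (natDegree_le_of_degree_le hlow.le) ?_)
    exact (natDegree_C_mul_le _ _).trans hmd.le
  · rw [coeff_add, coeff_eq_zero_of_degree_lt hlow, zero_add, coeff_C_mul, ← hmd,
      hm.coeff_natDegree, mul_one]

theorem monic_cohenRTransform {F : Type*} [Field F] {g : F[X]} (hg : g.Monic) :
    (cohenRTransform g).Monic :=
  monic_of_natDegree_le_of_coeff_eq_one _ (cohenRTransform_coeff_two_mul g).1
    ((cohenRTransform_coeff_two_mul g).2.trans hg)

theorem natDegree_cohenRTransform {F : Type*} [Field F] {g : F[X]} (hg : g.Monic) :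
    (cohenRTransform g).natDegree = 2 * g.natDegree :=
  natDegree_eq_of_le_of_coeff_ne_zero (cohenRTransform_coeff_two_mul g).1
    (by rw [(cohenRTransform_coeff_two_mul g).2, hg]; exact one_ne_zero)

theorem cohenRTransform_aeval_zero {F E : Type*} [Field F] [Field E] [Algebra F E] (g : F[X]) :
    aeval (0 : E) (cohenRTransform g) = algebraMap F E g.leadingCoeff := by
  rw [cohenRTransform, map_sum, Finset.sum_range_succ, Finset.sum_eq_zero]
  · simp
  · intro i hi
    have := Finset.mem_range.1 hi
    simp [zero_pow (show g.natDegree - i ≠ 0 by omega)]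

theorem add_two_div_sub_two_not_isSquare {F : Type*} [Field F] {a : F} (h2 : (2 : F) ≠ 0)
    (ha : Irreducible (X ^ 2 + C a * X + 1 : F[X])) : ¬IsSquare ((a + 2) / (a - 2)) := by
  have hroot : ∀ x : F, x ^ 2 + a * x + 1 ≠ 0 := by
    intro x hx
    have h1 := degree_eq_one_of_irreducible_of_root ha (x := x) (by simpa [IsRoot] using hx)
    have h3 : (X ^ 2 + C a * X + 1 : F[X]).degree = 2 := by compute_degree!
    rw [h3] at h1
    exact absurd h1 (by decide)
  have ha2 : a - 2 ≠ 0 := fun h => hroot (-1) (by linear_combination -h)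
  rintro ⟨e, he⟩
  have he' : a + 2 = e * e * (a - 2) := by rw [← he]; field_simp
  -- The quadratic formula, with e(a - 2) as a square root of a² - 4.
  refine hroot ((-a + e * (a - 2)) / 2) ?_
  field_simp
  linear_combination (-(a - 2)) * he'

/-- A root of the `k`-th iterated transform is the inverse Cayley transform of a `2 ^ k`-th root
of `(a + 2) / (a - 2)`. -/
theorem cayley_pow_eq_of_aeval_eq_zero {F E : Type*} [Field F] [Field E] [Algebra F E] {a : F}
    (h2 : (2 : F) ≠ 0) (ha : Irreducible (X ^ 2 + C a * X + 1 : F[X])) {g : ℕ → F[X]}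
    (hg1 : g 1 = X ^ 2 + C a * X + 1) (hg : ∀ k, 1 ≤ k → g (k + 1) = cohenRTransform (g k))
    (hmonic : ∀ k, 1 ≤ k → (g k).Monic) {k : ℕ} (hk : 1 ≤ k) {α : E} (hα : aeval α (g k) = 0) :
    α + 1 ≠ 0 ∧ ((α - 1) / (α + 1)) ^ 2 ^ k = algebraMap F E ((a + 2) / (a - 2)) := by
  have h2E : (2 : E) ≠ 0 := by
    rw [← map_ofNat (algebraMap F E) 2]
    exact (_root_.map_ne_zero _).2 h2
  have hsq := add_two_div_sub_two_not_isSquare h2 ha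
  have ha2 : a - 2 ≠ 0 := by
    intro h
    simp [h] at hsq
  have ha2E : algebraMap F E a - 2 ≠ 0 := by
    rw [← map_ofNat (algebraMap F E) 2, ← map_sub]
    exact (_root_.map_ne_zero _).2 ha2
  induction k, hk using Nat.le_induction generalizing α with
  | base =>
    rw [hg1] at hα
    simp only [map_add, map_mul, map_pow, aeval_X, aeval_C, map_one] at hα
    have h1 : α + 1 ≠ 0 := by
      intro h
      apply ha2E
      linear_combination -hα + (α + algebraMap F E a - 1) * h
    refine ⟨h1, ?_⟩
    rw [map_div₀, map_add, map_sub, map_ofNat, pow_one, div_pow, div_eq_div_iff (pow_ne_zero _ h1)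
      ha2E]
    linear_combination -4 * hα
  | succ k hk ih =>
    rw [hg k hk] at hα
    have hα0 : α ≠ 0 := by
      rintro rfl
      rw [cohenRTransform_aeval_zero, hmonic k hk, map_one] at hα
      exact one_ne_zero hα
    rw [aeval_cohenRTransform h2E _ _ hα0] at hα
    obtain ⟨h1, h⟩ := ih ((mul_eq_zero.1 hα).resolve_left (pow_ne_zero _ (mul_ne_zero h2E hα0)))
    have hα1 : α + 1 ≠ 0 := by
      intro h0
      apply h1
      field_simp
      linear_combination (α + 1) * h0
    refine ⟨hα1, ?_⟩
    rw [← h, pow_succ' 2 k, pow_mul]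
    congr 1
    have e1 : (α + 1 / α) / 2 - 1 = (α - 1) ^ 2 / (2 * α) := by field_simp; ring
    have e2 : (α + 1 / α) / 2 + 1 = (α + 1) ^ 2 / (2 * α) := by field_simp; ring
    rw [e1, e2, div_div_div_cancel_right₀ (mul_ne_zero h2E hα0), div_pow]

/-! ### Irreducibility and conclusion -/

theorem mainTheorem4 {F : Type*} [Field F] [Finite F] (hq : Nat.card F ≡ 1 [MOD 4])
    (a : F) (ha : Irreducible (X ^ 2 + C a * X + 1 : F[X]))
    (g : ℕ → F[X]) (hg1 : g 1 = X ^ 2 + C a * X + 1)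
    (hg : ∀ k, 1 ≤ k → g (k + 1) = cohenRTransform (g k))
    (k : ℕ) (hk : 1 ≤ k) :
    Irreducible (g k) ∧ (g k).natDegree = 2 ^ k ∧
      ∀ (L : Type*) [Field L] [Algebra F L], Module.finrank F L = (g k).natDegree →
        ∀ α : L, aeval α (g k) = 0 → IsCompletelyNormalElement F L α := by
  have h2 := two_ne_zero_of_card_modEq hq
  have hb := add_two_div_sub_two_not_isSquare h2 ha
  have hgk : ∀ k, 1 ≤ k → (g k).Monic ∧ (g k).natDegree = 2 ^ k := by
    intro k hk
    induction k, hk using Nat.le_induction with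
    | base =>
      rw [hg1]
      exact ⟨by monicity!, by compute_degree!⟩
    | succ k hk ih =>
      rw [hg k hk]
      exact ⟨monic_cohenRTransform ih.1, by rw [natDegree_cohenRTransform ih.1, ih.2, pow_succ']⟩
  have hmonic : ∀ k, 1 ≤ k → (g k).Monic := fun k hk => (hgk k hk).1
  have hdeg := (hgk k hk).2
  refine ⟨?_, hdeg, ?_⟩
  · obtain ⟨α, hα⟩ := IsAlgClosed.exists_aeval_eq_zero (AlgebraicClosure F) (g k) (by
      rw [degree_eq_natDegree (hmonic k hk).ne_zero, hdeg]
      exact_mod_cast (Nat.two_pow_pos k).ne')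
    have hint : IsIntegral F α := Algebra.IsIntegral.isIntegral α
    have : FiniteDimensional F (IntermediateField.adjoin F {α}) :=
      IntermediateField.adjoin.finiteDimensional hint
    have hgen : aeval (IntermediateField.AdjoinSimple.gen F α) (g k) = 0 := by
      rw [← minpoly.dvd_iff, IntermediateField.minpoly_gen]
      exact minpoly.dvd _ _ hα
    have hmin := minpoly_eq_X_pow_two_pow_sub_C hq hb k
      (cayley_pow_eq_of_aeval_eq_zero h2 ha hg1 hg hmonic hk hgen).2
    -- β lies in F(α) and has degree 2^k, so the minimal polynomial of α has degree at least that of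
    -- g_k and equals it.
    have hle := minpoly.natDegree_le (A := F) ((IntermediateField.AdjoinSimple.gen F α - 1) /
      (IntermediateField.AdjoinSimple.gen F α + 1))
    rw [hmin, natDegree_X_pow_sub_C, IntermediateField.adjoin.finrank hint, ← hdeg] at hle
    rw [eq_of_monic_of_dvd_of_natDegree_le (minpoly.monic hint) (hmonic k hk)
      (minpoly.dvd _ _ hα) hle]
    exact minpoly.irreducible hint
  · intro L _ _ hL α hα
    obtain ⟨h1, hβ⟩ := cayley_pow_eq_of_aeval_eq_zero h2 ha hg1 hg hmonic hk hα
    refine isCompletelyNormalElement_cayley hq hb (hL.trans hdeg) hβ ?_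
    field_simp
    ring
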